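/- Let $G$ be a profinite group. A spectrum is a Bousfield--Friedlander spectrum of simplicial sets, i.e. a sequence of pointed simplicial sets $X_k$ ($k\ge 0$) with bonding maps $S^1\wedge X_k\to X_{k+1}$; let $\mathrm{Spt}$ be the category of spectra. A discrete $G$-spectrum is a spectrum with a $G$-action such that, for all $k,l\ge 0$, the action map $G\times (X_k)_l\to (X_k)_l$ is continuous when the set $(X_k)_l$ of $l$-simplices is given the discrete topology; let $\mathrm{Spt}_G$ be the category of discrete $G$-spectra and $G$-equivariant maps of spectra. For $\mathcal M=\mathrm{Spt}$ or $\mathrm{Spt}_G$ and a simplicial set $K$, let $Y\mapsto Y^K$ be the cotensor in $\mathcal M$, that is, the right adjoint of the functor $A\mapsto A\wedge K_+$ on $\mathcal M$ (where $G$ acts on $A$ only). For a small category $\mathcal C$ and a functor $X\colon\mathcal C\to\mathcal M$, the homotopy limit $\operatorname{holim}^{\mathcal M}_{\mathcal C}X$ is the equalizer in $\mathcal M$ of the two maps \[ \alpha,\beta\colon \prod_{c\in\mathcal C}X(c)^{B(\mathcal C\downarrow c)}\rightrightarrows\prod_{\sigma\colon c\to d}X(d)^{B(\mathcal C\downarrow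 c)}, \] where $B$ denotes the nerve, the second product is over all morphisms of $\mathcal C$, and, on the factor of $\sigma\colon c\to d$, $\alpha$ is the projection to $X(c)^{B(\mathcal C\downarrow c)}$ followed by the map induced by $X(\sigma)$, and $\beta$ is the projection to $X(d)^{B(\mathcal C\downarrow d)}$ followed by the map induced by $B(\mathcal C\downarrow c)\to B(\mathcal C\downarrow d)$. Let $\mathcal C$ be a small category and $X\colon \mathcal C\to\mathrm{Spt}_G$ a functor. Let $\operatorname{holim}_{\mathcal C}X$ be the homotopy limit in $\mathrm{Spt}$ of the underlying diagram of spectra, with the $G$-action induced by functoriality. Then there is an isomorphism of discrete $G$-spectra \[ \operatorname{holim}^{\mathrm{Spt}_G}_{\mathcal C}X\;\cong\;\operatorname*{colim}_{N\vartriangleleft_o G}\,(\operatorname{holim}_{\mathcal C}X)^N, \] where $N$ runs over the open normal subgroups of $G$, the transition maps are the inclusions of fixed points, and the colimit exists in $\mathrm{Spt}_G$ and is also the colimit in $\mathrm{Spt}$ of the underlying diagram. -/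

import Mathlib

open CategoryTheory Limits Opposite Simplicial

universe u

/-- A pointed simplicial set: a simplicial set with a base point in each degree, compatible with
all the simplicial operators (that is, a map from the terminal simplicial set). -/
structure PSSet where
  X : SSet.{u}
  pt : ∀ n, X.obj n
  map_pt : ∀ {m n : SimplexCategoryᵒᵖ} (f : m ⟶ n), X.map f (pt m) = pt n

namespace PSSet

attribute [simp] map_pt

@[ext]
structure Hom (A B : PSSet.{u}) where
  hom : A.X ⟶ B.X
  app_pt : ∀ n, hom.app n (A.pt n) = B.pt n

attribute [simp] Hom.app_pt

instance : Category PSSet.{u} where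
  Hom := Hom
  id A := ⟨𝟙 A.X, fun _ => rfl⟩
  comp f g := ⟨f.hom ≫ g.hom, fun n => by simp⟩

/-- The effect of a map of pointed simplicial sets on `n`-simplices. -/
def ap {A B : PSSet.{u}} (f : A ⟶ B) (n : SimplexCategoryᵒᵖ) (x : A.X.obj n) : B.X.obj n :=
  (Hom.hom f).app n x

@[simp] lemma ap_id (A : PSSet.{u}) (n) (x : A.X.obj n) : ap (𝟙 A) n x = x := rfl

@[simp] lemma ap_comp {A B C : PSSet.{u}} (f : A ⟶ B) (g : B ⟶ C) (n) (x : A.X.obj n) :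
    ap (f ≫ g) n x = ap g n (ap f n x) := rfl

@[simp] lemma ap_pt {A B : PSSet.{u}} (f : A ⟶ B) (n) : ap f n (A.pt n) = B.pt n :=
  Hom.app_pt f n

lemma ap_map {A B : PSSet.{u}} (f : A ⟶ B) {m n} (s : m ⟶ n) (x : A.X.obj m) :
    ap f n (A.X.map s x) = B.X.map s (ap f m x) :=
  NatTrans.naturality_apply (Hom.hom f) s x

lemma hom_ext {A B : PSSet.{u}} {f g : A ⟶ B} (h : ∀ n x, ap f n x = ap g n x) : f = g := by
  apply Hom.ext
  ext n x
  exact h n x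

/-- Constructor for maps of pointed simplicial sets from functions on simplices. -/
def mkHom {A B : PSSet.{u}} (f : ∀ n, A.X.obj n → B.X.obj n)
    (hmap : ∀ {m n} (s : m ⟶ n) (x : A.X.obj m), f n (A.X.map s x) = B.X.map s (f m x))
    (hpt : ∀ n, f n (A.pt n) = B.pt n) : A ⟶ B :=
  Hom.mk { app := fun n => ↾(f n), naturality := fun _ _ s => by ext x; exact hmap s x } hpt

@[simp] lemma ap_mkHom {A B : PSSet.{u}} (f : ∀ n, A.X.obj n → B.X.obj n) (hmap) (hpt) (n) (x) :
    ap (mkHom (A := A) (B := B) f hmap hpt) n x = f n x := rfl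

/-- The relation on `A_n × B_n` that collapses the wedge `A_n ∨ B_n` to a point. -/
def smashRel (A B : PSSet.{u}) (n : SimplexCategoryᵒᵖ) (p q : A.X.obj n × B.X.obj n) : Prop :=
  (p.1 = A.pt n ∨ p.2 = B.pt n) ∧ (q.1 = A.pt n ∨ q.2 = B.pt n)

/-- The smash product `A ∧ B = (A × B) / (A ∨ B)` of pointed simplicial sets. -/
def smash (A B : PSSet.{u}) : PSSet.{u} where
  X :=
    { obj := fun n => Quot (smashRel A B n)
      map := fun {m n} s => ↾(Quot.map (fun p => (A.X.map s p.1, B.X.map s p.2)) (by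
        rintro ⟨a, b⟩ ⟨a', b'⟩ ⟨h, h'⟩
        refine ⟨h.imp ?_ ?_, h'.imp ?_ ?_⟩ <;> (intro h; dsimp only at h ⊢; rw [h]; simp)))
      map_id := fun n => by
        ext ⟨p⟩
        simp [Quot.map]
      map_comp := fun s t => by
        ext ⟨p⟩
        simp [Quot.map] }
  pt n := Quot.mk _ (A.pt n, B.pt n)
  map_pt s := by
    change Quot.mk _ (A.X.map s (A.pt _), B.X.map s (B.pt _)) = _
    simp

/-- The class of the pair `(a, b)` in the smash product. -/
def smk {A B : PSSet.{u}} {n : SimplexCategoryᵒᵖ} (a : A.X.obj n) (b : B.X.obj n) :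
    (smash A B).X.obj n := Quot.mk _ (a, b)

lemma smash_map {A B : PSSet.{u}} {m n : SimplexCategoryᵒᵖ} (s : m ⟶ n) (a : A.X.obj m)
    (b : B.X.obj m) : (smash A B).X.map s (smk a b) = smk (A.X.map s a) (B.X.map s b) := rfl

lemma smash_pt {A B : PSSet.{u}} (n) : (smash A B).pt n = smk (A.pt n) (B.pt n) := rfl

lemma smk_left {A B : PSSet.{u}} {n} (b : B.X.obj n) :
    smk (A.pt n) b = (smash A B).pt n := Quot.sound ⟨Or.inl rfl, Or.inl rfl⟩

lemma smk_right {A B : PSSet.{u}} {n} (a : A.X.obj n) :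
    smk a (B.pt n) = (smash A B).pt n := Quot.sound ⟨Or.inr rfl, Or.inl rfl⟩

lemma smash_ind {A B : PSSet.{u}} {n} {P : (smash A B).X.obj n → Prop}
    (h : ∀ a b, P (smk a b)) (x) : P x := by
  rcases x with ⟨a, b⟩
  exact h a b

/-- Functions out of the `n`-simplices of a smash product. -/
def smashLift {A B : PSSet.{u}} {n} {T : Type*} (f : A.X.obj n → B.X.obj n → T) (t : T)
    (hl : ∀ b, f (A.pt n) b = t) (hr : ∀ a, f a (B.pt n) = t) (x : (smash A B).X.obj n) : T :=
  Quot.lift (fun p : A.X.obj n × B.X.obj n => f p.1 p.2) (by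
    have key : ∀ p : A.X.obj n × B.X.obj n, (p.1 = A.pt n ∨ p.2 = B.pt n) → f p.1 p.2 = t := by
      rintro ⟨a, b⟩ (h | h) <;> (dsimp only at h ⊢; subst h; simp [hl, hr])
    rintro p q ⟨h, h'⟩
    exact (key p h).trans (key q h').symm) x

@[simp] lemma smashLift_smk {A B : PSSet.{u}} {n} {T : Type*} (f : A.X.obj n → B.X.obj n → T)
    (t : T) (hl hr) (a : A.X.obj n) (b : B.X.obj n) :
    smashLift f t hl hr (smk a b) = f a b := rfl

/-- Maps out of a smash product. -/
def smashDesc {A B C : PSSet.{u}} (f : ∀ n, A.X.obj n → B.X.obj n → C.X.obj n)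
    (hl : ∀ n b, f n (A.pt n) b = C.pt n) (hr : ∀ n a, f n a (B.pt n) = C.pt n)
    (hmap : ∀ {m n} (s : m ⟶ n) a b, f n (A.X.map s a) (B.X.map s b) = C.X.map s (f m a b)) :
    smash A B ⟶ C :=
  mkHom (fun n => smashLift (f n) (C.pt n) (hl n) (hr n))
    (fun {m n} s x => by
      induction x using smash_ind with
      | h a b => simp [smash_map, hmap])
    (fun n => by simp [smash_pt, hl])

@[simp] lemma smashDesc_smk {A B C : PSSet.{u}} (f : ∀ n, A.X.obj n → B.X.obj n → C.X.obj n)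
    (hl) (hr) (hmap) (n) (a : A.X.obj n) (b : B.X.obj n) :
    ap (smashDesc (C := C) f hl hr hmap) n (smk a b) = f n a b := rfl

/-- The functoriality of the smash product. -/
def smashMap {A A' B B' : PSSet.{u}} (f : A ⟶ A') (g : B ⟶ B') : smash A B ⟶ smash A' B' :=
  smashDesc (fun n a b => smk (ap f n a) (ap g n b)) (fun n b => by simp [smk_left])
    (fun n a => by simp [smk_right]) (fun s a b => by simp [ap_map, smash_map])

@[simp] lemma smashMap_smk {A A' B B' : PSSet.{u}} (f : A ⟶ A') (g : B ⟶ B') (n)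
    (a : A.X.obj n) (b : B.X.obj n) :
    ap (smashMap f g) n (smk a b) = smk (ap f n a) (ap g n b) := rfl

/-- The associativity map `A ∧ (B ∧ C) ⟶ (A ∧ B) ∧ C`. -/
def smashAssoc (A B C : PSSet.{u}) : smash A (smash B C) ⟶ smash (smash A B) C :=
  smashDesc
    (fun n a => smashLift (fun b c => smk (smk a b) c) ((smash (smash A B) C).pt n)
      (fun c => by rw [smk_right, smk_left]) (fun b => by rw [smk_right]))
    (fun n x => by
      induction x using smash_ind with
      | h b c => rw [smashLift_smk, smk_left, smk_left])
    (fun n a => smk_right (smk a (B.pt n)))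
    (fun {m n} s a x => by
      induction x using smash_ind with
      | h b c => simp [smash_map])

@[simp] lemma smashAssoc_smk {A B C : PSSet.{u}} {n} (a : A.X.obj n) (b : B.X.obj n)
    (c : C.X.obj n) : ap (smashAssoc A B C) n (smk a (smk b c)) = smk (smk a b) c := rfl

/-- `K₊`, the simplicial set `K` with a disjoint base point. -/
def plus (K : SSet.{u}) : PSSet.{u} where
  X :=
    { obj := fun n => Option (K.obj n)
      map := fun s => ↾(Option.map (K.map s))
      map_id := fun n => by ext (_ | x) <;> simp
      map_comp := fun s t => by ext (_ | x) <;> simp }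
  pt _ := none
  map_pt _ := rfl

lemma plus_map_some {K : SSet.{u}} {m n : SimplexCategoryᵒᵖ} (s : m ⟶ n) (x : K.obj m) :
    (plus K).X.map s (some x : Option (K.obj m)) = (some (K.map s x) : Option (K.obj n)) := rfl

/-- The functoriality of `K ↦ K₊`. -/
def plusMap {K L : SSet.{u}} (f : K ⟶ L) : plus K ⟶ plus L :=
  mkHom (fun n => Option.map (f.app n))
    (fun {m n} s x => by
      rcases x with _ | x
      · rfl
      · exact congrArg some (NatTrans.naturality_apply f s x))
    (fun _ => rfl)

/-- The simplicial circle `S¹ = Δ¹ / ∂Δ¹`, pointed by the class of `∂Δ¹`. -/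
def circle : PSSet.{u} where
  X :=
    { obj := fun n => Quot (fun x y : (Δ[1] : SSet.{u}).obj n =>
        x ∈ (SSet.boundary.{u} 1).obj n ∧ y ∈ (SSet.boundary.{u} 1).obj n)
      map := fun s => ↾(Quot.map ((Δ[1] : SSet.{u}).map s) (fun _ _ h =>
        ⟨(SSet.boundary 1).map s h.1, (SSet.boundary 1).map s h.2⟩))
      map_id := fun n => by
        ext ⟨p⟩
        simp [Quot.map]
      map_comp := fun s t => by
        ext ⟨p⟩
        simp [Quot.map] }
  pt n := Quot.mk _ (SSet.stdSimplex.const 1 0 n)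
  map_pt _ := rfl

end PSSet

/-- A (Bousfield-Friedlander) spectrum of simplicial sets: pointed simplicial sets `X_k` with
bonding maps `S¹ ∧ X_k ⟶ X_{k+1}`. -/
structure Spt where
  level : ℕ → PSSet.{u}
  bond : ∀ k, PSSet.smash PSSet.circle (level k) ⟶ level (k + 1)

namespace Spt

open PSSet

@[ext]
structure Hom (X Y : Spt.{u}) where
  app : ∀ k, X.level k ⟶ Y.level k
  comm : ∀ k, smashMap (𝟙 circle) (app k) ≫ Y.bond k = X.bond k ≫ app (k + 1)

/-- The `n`-simplices of the `k`-th level of a spectrum. -/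
abbrev S (X : Spt.{u}) (k : ℕ) (n : SimplexCategoryᵒᵖ) : Type u := (X.level k).X.obj n

/-- The bonding map evaluated on the class of a pair of simplices. -/
def bd (X : Spt.{u}) (k : ℕ) (n : SimplexCategoryᵒᵖ) (s : circle.{u}.X.obj n) (x : X.S k n) :
    X.S (k + 1) n := ap (X.bond k) n (smk s x)

@[simp] lemma bd_pt (X : Spt.{u}) (k n) (s) : X.bd k n s ((X.level k).pt n)
    = (X.level (k + 1)).pt n := by rw [bd, smk_right, ap_pt]

@[simp] lemma bd_pt_left (X : Spt.{u}) (k n) (x) : X.bd k n (circle.pt n) x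
    = (X.level (k + 1)).pt n := by rw [bd, smk_left, ap_pt]

lemma bd_map (X : Spt.{u}) (k) {m n} (t : m ⟶ n) (s) (x : X.S k m) :
    X.bd k n (circle.X.map t s) ((X.level k).X.map t x)
    = (X.level (k + 1)).X.map t (X.bd k m s x) := by
  rw [bd, ← smash_map, ap_map, bd]

/-- Constructor for spectra from functions `S¹_n × (X_k)_n → (X_{k+1})_n` that vanish on the
wedge. -/
def mk' (L : ℕ → PSSet.{u})
    (f : ∀ k n, circle.{u}.X.obj n → (L k).X.obj n → (L (k + 1)).X.obj n)
    (hl : ∀ k n x, f k n (circle.pt n) x = (L (k + 1)).pt n)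
    (hr : ∀ k n s, f k n s ((L k).pt n) = (L (k + 1)).pt n)
    (hmap : ∀ k {m n} (t : m ⟶ n) s x,
      f k n (circle.X.map t s) ((L k).X.map t x) = (L (k + 1)).X.map t (f k m s x)) : Spt.{u} where
  level := L
  bond k := smashDesc (f k) (hl k) (hr k) (hmap k)

lemma Hom.app_bd {X Y : Spt.{u}} (f : Hom X Y) (k n) (s) (x : X.S k n) :
    ap (f.app (k + 1)) n (X.bd k n s x) = Y.bd k n s (ap (f.app k) n x) := by
  have := congrArg (fun φ => ap φ n (smk s x)) (f.comm k)
  simpa [bd] using this.symm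

lemma comm_of_bd {X Y : Spt.{u}} (f : ∀ k, X.level k ⟶ Y.level k)
    (h : ∀ k n s (x : X.S k n), ap (f (k + 1)) n (X.bd k n s x) = Y.bd k n s (ap (f k) n x)) (k) :
    smashMap (𝟙 circle) (f k) ≫ Y.bond k = X.bond k ≫ f (k + 1) := by
  apply PSSet.hom_ext
  intro n x
  induction x using smash_ind with
  | h a b => exact (h k n a b).symm

instance : Category Spt.{u} where
  Hom := Hom
  id X := ⟨fun k => 𝟙 _, comm_of_bd _ fun k n s x => by simp⟩
  comp f g := ⟨fun k => f.app k ≫ g.app k, comm_of_bd _ fun k n s x => by simp [Hom.app_bd]⟩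

/-- The effect of a map of spectra on simplices. -/
def ev {X Y : Spt.{u}} (f : X ⟶ Y) (k : ℕ) (n : SimplexCategoryᵒᵖ) (x : X.S k n) : Y.S k n :=
  ap (Hom.app f k) n x

@[simp] lemma ev_id (X : Spt.{u}) (k n) (x : X.S k n) : ev (𝟙 X) k n x = x := rfl

@[simp] lemma ev_comp {X Y Z : Spt.{u}} (f : X ⟶ Y) (g : Y ⟶ Z) (k n) (x : X.S k n) :
    ev (f ≫ g) k n x = ev g k n (ev f k n x) := rfl

@[simp] lemma ev_pt {X Y : Spt.{u}} (f : X ⟶ Y) (k n) :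
    ev f k n ((X.level k).pt n) = (Y.level k).pt n := ap_pt _ _

lemma ev_map {X Y : Spt.{u}} (f : X ⟶ Y) (k) {m n} (s : m ⟶ n) (x : X.S k m) :
    ev f k n ((X.level k).X.map s x) = (Y.level k).X.map s (ev f k m x) := ap_map _ _ _

lemma ev_bd {X Y : Spt.{u}} (f : X ⟶ Y) (k n) (s) (x : X.S k n) :
    ev f (k + 1) n (X.bd k n s x) = Y.bd k n s (ev f k n x) := Hom.app_bd f k n s x

lemma hom_ext {X Y : Spt.{u}} {f g : X ⟶ Y} (h : ∀ k n x, ev f k n x = ev g k n x) : f = g := by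
  apply Hom.ext
  funext k
  exact PSSet.hom_ext (h k)

lemma congr_ev {X Y : Spt.{u}} {f g : X ⟶ Y} (h : f = g) (k n) (x : X.S k n) :
    ev f k n x = ev g k n x := by rw [h]

/-- Constructor for maps of spectra from functions on simplices. -/
def mkHom {X Y : Spt.{u}} (f : ∀ k n, X.S k n → Y.S k n)
    (hmap : ∀ k {m n} (s : m ⟶ n) (x : X.S k m),
      f k n ((X.level k).X.map s x) = (Y.level k).X.map s (f k m x))
    (hpt : ∀ k n, f k n ((X.level k).pt n) = (Y.level k).pt n)
    (hbd : ∀ k n s (x : X.S k n), f (k + 1) n (X.bd k n s x) = Y.bd k n s (f k n x)) : X ⟶ Y :=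
  Hom.mk (fun k => PSSet.mkHom (f k) (hmap k) (hpt k)) (comm_of_bd _ hbd)

@[simp] lemma ev_mkHom {X Y : Spt.{u}} (f : ∀ k n, X.S k n → Y.S k n) (hmap hpt hbd) (k n x) :
    ev (mkHom (X := X) (Y := Y) f hmap hpt hbd) k n x = f k n x := rfl

/-! ### Limits of spectra -/

section Limits

variable {J : Type u} [SmallCategory J] (F : J ⥤ Spt.{u})

/-- The limit of a diagram of spectra, formed on simplices. -/
def lim : Spt.{u} :=
  mk'
    (fun k =>
      { X :=
          { obj := fun n => { s : ∀ j, (F.obj j).S k n //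
              ∀ {i j} (f : i ⟶ j), ev (F.map f) k n (s i) = s j }
            map := fun t => ↾fun s => ⟨fun j => ((F.obj j).level k).X.map t (s.1 j),
              fun f => by rw [ev_map, s.2 f]⟩
            map_id := fun n => by ext s j; simp
            map_comp := fun s t => by ext s j; simp }
        pt := fun n => ⟨fun j => ((F.obj j).level k).pt n, fun f => by simp⟩
        map_pt := fun t => by apply Subtype.ext; funext j; simp })
    (fun k n s x => ⟨fun j => (F.obj j).bd k n s (x.1 j), fun f => by rw [ev_bd, x.2 f]⟩)
    (fun k n x => by apply Subtype.ext; funext j; simp)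
    (fun k n s => by apply Subtype.ext; funext j; simp)
    (fun k m n t s x => by
      apply Subtype.ext; funext j
      exact bd_map _ k t s _)

/-- The limit cone on `lim F`. -/
def limCone : Cone F where
  pt := lim F
  π :=
    { app := fun j => mkHom (fun k n s => s.1 j) (fun _ _ _ _ _ => rfl) (fun _ _ => rfl)
        (fun _ _ _ _ => rfl)
      naturality := fun i j f => by
        apply hom_ext
        intro k n x
        exact (x.2 f).symm }

/-- The universal property of `lim F`. -/
def limConeIsLimit : IsLimit (limCone F) where
  lift c := mkHom (fun k n x => ⟨fun j => ev (c.π.app j) k n x,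
      fun f => by rw [← ev_comp]; exact congr_ev (c.w f) k n x⟩)
    (fun k m n s x => by apply Subtype.ext; funext j; exact ev_map _ _ _ _)
    (fun k n => by apply Subtype.ext; funext j; exact ev_pt _ _ _)
    (fun k n s x => by apply Subtype.ext; funext j; exact ev_bd _ _ _ _ _)
  fac c j := rfl
  uniq c m h := by
    apply hom_ext
    intro k n x
    apply Subtype.ext
    funext j
    exact congr_ev (h j) k n x

end Limits

instance : HasLimits Spt.{u} where
  has_limits_of_shape _ := ⟨fun F => ⟨⟨⟨limCone F, limConeIsLimit F⟩⟩⟩⟩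

/-! ### Tensors and cotensors with simplicial sets -/

/-- The tensor `X ∧ K₊`: level `k` is `X_k ∧ K₊`, and the bonding maps are
`S¹ ∧ (X_k ∧ K₊) ≅ (S¹ ∧ X_k) ∧ K₊ ⟶ X_{k+1} ∧ K₊`. -/
def tens (X : Spt.{u}) (K : SSet.{u}) : Spt.{u} where
  level k := smash (X.level k) (plus K)
  bond k := smashAssoc _ _ _ ≫ smashMap (X.bond k) (𝟙 _)

/-- The class of a pair of simplices in `X ∧ K₊`. -/
def tmk {X : Spt.{u}} {K : SSet.{u}} {k : ℕ} {n : SimplexCategoryᵒᵖ} (x : X.S k n)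
    (y : Option (K.obj n)) : (tens X K).S k n := smk (B := plus K) x y

lemma tens_ind {X : Spt.{u}} {K : SSet.{u}} {k n} {P : (tens X K).S k n → Prop}
    (h : ∀ x y, P (tmk x y)) (z) : P z := smash_ind (P := P) h z

lemma tens_bd (X : Spt.{u}) (K : SSet.{u}) (k n s) (x : X.S k n) (y : Option (K.obj n)) :
    (tens X K).bd k n s (tmk x y) = tmk (X.bd k n s x) y := rfl

lemma tmk_none {X : Spt.{u}} {K : SSet.{u}} {k n} (x : X.S k n) :
    tmk x (none : Option (K.obj n)) = ((tens X K).level k).pt n := smk_right (B := plus K) x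

lemma tmk_pt {X : Spt.{u}} {K : SSet.{u}} {k n} (y : Option (K.obj n)) :
    tmk ((X.level k).pt n) y = ((tens X K).level k).pt n := smk_left (B := plus K) y

lemma tens_map {X : Spt.{u}} {K : SSet.{u}} {k m n} (s : m ⟶ n) (x : X.S k m) (y : K.obj m) :
    ((tens X K).level k).X.map s (tmk x (some y)) =
      tmk ((X.level k).X.map s x) (some (K.map s y)) := rfl

/-- The functoriality of `X ∧ K₊` in both variables. -/
def tensMap {X Y : Spt.{u}} {K L : SSet.{u}} (f : X ⟶ Y) (g : K ⟶ L) : tens X K ⟶ tens Y L :=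
  Hom.mk (fun k => smashMap (Hom.app f k) (plusMap g)) (comm_of_bd _ fun k n s x => by
    induction x using tens_ind with
    | h a b => exact congrArg (fun z => tmk z (b.map (g.app n))) (ev_bd f k n s a))

lemma ev_tensMap {X Y : Spt.{u}} {K L : SSet.{u}} (f : X ⟶ Y) (g : K ⟶ L) (k n) (x : X.S k n)
    (y : Option (K.obj n)) :
    ev (tensMap f g) k n (tmk x y) = tmk (ev f k n x) (y.map (g.app n)) := rfl

/-- The tensoring of spectra over simplicial sets, `K ↦ (X ↦ X ∧ K₊)`. -/
def tensor : SSet.{u} ⥤ Spt.{u} ⥤ Spt.{u} where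
  obj K :=
    { obj := fun X => tens X K
      map := fun f => tensMap f (𝟙 K)
      map_id := fun X => by
        apply hom_ext
        intro k n x
        induction x using tens_ind with
        | h a b => rcases b with _ | b <;> rfl
      map_comp := fun f g => by
        apply hom_ext
        intro k n x
        induction x using tens_ind with
        | h a b => rcases b with _ | b <;> rfl }
  map g :=
    { app := fun X => tensMap (𝟙 X) g
      naturality := fun X Y f => by
        apply hom_ext
        intro k n x
        induction x using tens_ind with
        | h a b => rcases b with _ | b <;> rfl }
  map_id K := by
    ext X : 2
    apply hom_ext
    intro k n x
    induction x using tens_ind with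
    | h a b => rcases b with _ | b <;> rfl
  map_comp f g := by
    ext X : 2
    apply hom_ext
    intro k n x
    induction x using tens_ind with
    | h a b => rcases b with _ | b <;> rfl

/-- An `n`-simplex of the mapping space `Map(K, A)`: a map `Δⁿ × K ⟶ A`, written as a natural
family of functions `(Δⁿ)_m → K_m → A_m`. -/
@[ext]
structure MapS (K : SSet.{u}) (A : PSSet.{u}) (n : SimplexCategoryᵒᵖ) where
  fn : ∀ m, (n ⟶ m) → K.obj m → A.X.obj m
  nat : ∀ {m l} (t : m ⟶ l) (a : n ⟶ m) (x : K.obj m), fn l (a ≫ t) (K.map t x) =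
    A.X.map t (fn m a x)

/-- The mapping space `Map(K, A)`, pointed by the constant map at the base point. -/
def mapSpace (K : SSet.{u}) (A : PSSet.{u}) : PSSet.{u} where
  X :=
    { obj := fun n => MapS K A n
      map := fun t => ↾fun φ => ⟨fun m a x => φ.fn m (t ≫ a) x, fun s a x => by
        rw [← φ.nat, Category.assoc]⟩
      map_id := fun n => by ext φ m a x; simp
      map_comp := fun s t => by ext φ m a x; simp }
  pt n := ⟨fun m _ _ => A.pt m, fun _ _ _ => by simp⟩
  map_pt _ := rfl

/-- The spectrum with levels `Map(K, X_k)`. -/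
def cot (K : SSet.{u}) (X : Spt.{u}) : Spt.{u} :=
  mk' (fun k => mapSpace K (X.level k))
    (fun k n s φ => ⟨fun m a x => X.bd k m (circle.X.map a s) (φ.fn m a x), fun t a x => by
      rw [φ.nat, ← bd_map, Functor.map_comp_apply]⟩)
    (fun k n φ => by
      apply MapS.ext; funext m a x
      change X.bd k m (circle.X.map a (circle.pt n)) _ = _
      rw [PSSet.map_pt, bd_pt_left]; rfl)
    (fun k n s => by
      apply MapS.ext; funext m a x
      exact bd_pt _ _ _ _)
    (fun k m n t s φ => by
      apply MapS.ext; funext l a x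
      change X.bd k l (circle.X.map a (circle.X.map t s)) _ = X.bd k l (circle.X.map (t ≫ a) s) _
      rw [Functor.map_comp_apply]; rfl)

/-- The value of a simplex of `Map(K, X_k)`. -/
def cfn {K : SSet.{u}} {X : Spt.{u}} {k : ℕ} {n : SimplexCategoryᵒᵖ} (φ : (cot K X).S k n)
    (m) (a : n ⟶ m) (x : K.obj m) : X.S k m := MapS.fn φ m a x

lemma cot_ext {K : SSet.{u}} {X : Spt.{u}} {k n} {φ ψ : (cot K X).S k n}
    (h : ∀ m a x, cfn φ m a x = cfn ψ m a x) : φ = ψ :=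
  MapS.ext (by funext m a x; exact h m a x)

lemma cfn_nat {K : SSet.{u}} {X : Spt.{u}} {k n} (φ : (cot K X).S k n) {m l} (t : m ⟶ l)
    (a : n ⟶ m) (x : K.obj m) :
    cfn φ l (a ≫ t) (K.map t x) = (X.level k).X.map t (cfn φ m a x) := MapS.nat φ t a x

lemma cfn_map {K : SSet.{u}} {X : Spt.{u}} {k n n'} (s : n ⟶ n') (φ : (cot K X).S k n) (m)
    (a : n' ⟶ m) (x : K.obj m) :
    cfn (((cot K X).level k).X.map s φ) m a x = cfn φ m (s ≫ a) x := rfl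

lemma cfn_pt {K : SSet.{u}} {X : Spt.{u}} {k n} (m) (a : n ⟶ m) (x : K.obj m) :
    cfn (((cot K X).level k).pt n) m a x = (X.level k).pt m := rfl

lemma cfn_bd {K : SSet.{u}} {X : Spt.{u}} {k n} (s) (φ : (cot K X).S k n) (m)
    (a : n ⟶ m) (x : K.obj m) :
    cfn ((cot K X).bd k n s φ) m a x = X.bd k m (circle.X.map a s) (cfn φ m a x) := rfl

/-- The map `A ⟶ Map(K, Y)` adjoint to `A ∧ K₊ ⟶ Y`. -/
def curry {K : SSet.{u}} {A Y : Spt.{u}} (f : tens A K ⟶ Y) : A ⟶ cot K Y :=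
  mkHom
    (fun k n a => MapS.mk (fun m t x => ev f k m (tmk ((A.level k).X.map t a) (some x)))
      (fun {m l} t b x => by rw [Functor.map_comp_apply, ← tens_map, ev_map]))
    (fun k m n s a => by
      apply cot_ext; intro l t x
      change ev f k l (tmk _ _) = ev f k l (tmk ((A.level k).X.map (s ≫ t) a) _)
      rw [Functor.map_comp_apply])
    (fun k n => by
      apply cot_ext; intro l t x
      change ev f k l (tmk _ _) = _
      rw [PSSet.map_pt, tmk_pt, ev_pt]; rfl)
    (fun k n s a => by
      apply cot_ext; intro l t x
      change ev f (k + 1) l (tmk _ _) = Y.bd k l (circle.X.map t s) (ev f k l (tmk _ _))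
      rw [← ev_bd, tens_bd, bd_map])

lemma cfn_curry {K : SSet.{u}} {A Y : Spt.{u}} (f : tens A K ⟶ Y) (k n a m) (t : n ⟶ m) (x) :
    cfn (ev (curry f) k n a) m t x = ev f k m (tmk ((A.level k).X.map t a) (some x)) := rfl

/-- The map `A ∧ K₊ ⟶ Y` adjoint to `A ⟶ Map(K, Y)`. -/
def uncurry {K : SSet.{u}} {A Y : Spt.{u}} (g : A ⟶ cot K Y) : tens A K ⟶ Y :=
  Hom.mk (fun k => smashDesc (B := plus K)
      (fun n a (y : Option (K.obj n)) => y.elim ((Y.level k).pt n)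
        (fun x => cfn (ev g k n a) n (𝟙 n) x))
      (fun n y => by
        rcases y with _ | x
        · rfl
        · change cfn (ev g k n _) n (𝟙 n) x = _
          rw [ev_pt, cfn_pt])
      (fun n a => rfl)
      (fun {m n} s a y => by
        rcases y with _ | x
        · exact (PSSet.map_pt _ s).symm
        · change cfn (ev g k n _) n (𝟙 n) (K.map s x) =
            (Y.level k).X.map s (cfn (ev g k m a) m (𝟙 m) x)
          rw [← cfn_nat, ev_map, cfn_map, Category.comp_id, Category.id_comp]))
    (comm_of_bd _ fun k n s x => by
      induction x using tens_ind with
      | h a y =>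
        rw [tens_bd]
        rcases y with _ | x
        · exact (bd_pt _ _ _ _).symm
        · change cfn (ev g (k + 1) n _) n (𝟙 n) x =
            Y.bd k n s (cfn (ev g k n a) n (𝟙 n) x)
          rw [ev_bd, cfn_bd, Functor.map_id_apply])

lemma ev_uncurry {K : SSet.{u}} {A Y : Spt.{u}} (g : A ⟶ cot K Y) (k n) (a : A.S k n)
    (x : K.obj n) : ev (uncurry g) k n (tmk a (some x)) = cfn (ev g k n a) n (𝟙 n) x := rfl

/-- The adjunction between `A ∧ K₊` and `Map(K, Y)`. -/
def cotEquiv (K : SSet.{u}) (A Y : Spt.{u}) : (tens A K ⟶ Y) ≃ (A ⟶ cot K Y) where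
  toFun := curry
  invFun := uncurry
  left_inv f := by
    apply hom_ext
    intro k n x
    induction x using tens_ind with
    | h a y =>
      rcases y with _ | x
      · rw [tmk_none, ev_pt, ev_pt]
      · rw [ev_uncurry, cfn_curry, Functor.map_id_apply]
  right_inv g := by
    apply hom_ext
    intro k n a
    apply cot_ext; intro m t x
    rw [cfn_curry, ev_uncurry, ev_map, cfn_map, Category.comp_id]

lemma curry_comp {K : SSet.{u}} {A' A Y : Spt.{u}} (f : A' ⟶ A) (g : tens A K ⟶ Y) :
    curry (tensMap f (𝟙 K) ≫ g) = f ≫ curry g := by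
  apply hom_ext
  intro k n a
  apply cot_ext; intro m t x
  rw [ev_comp, cfn_curry, cfn_curry, ev_comp, ev_tensMap, ev_map]
  rfl

/-- The tensor functor `- ∧ K₊` has a right adjoint. -/
instance (K : SSet.{u}) : (tensor.obj K).IsLeftAdjoint :=
  (Adjunction.adjunctionOfEquivRight (F := tensor.obj K) (cotEquiv K)
    (fun _ _ _ f g => curry_comp f g)).isLeftAdjoint

end Spt

/-! ### Homotopy limits in a category tensored over simplicial sets -/

section Holim

variable {M : Type*} [Category* M] (T : SSet.{u} ⥤ M ⥤ M) [∀ K, (T.obj K).IsLeftAdjoint]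

/-- The cotensor `Y ↦ Y^K`, the right adjoint of the tensor `A ↦ A ⊗ K`. -/
noncomputable def cotensor (K : SSet.{u}) : M ⥤ M := (T.obj K).rightAdjoint

/-- The map `Y^L ⟶ Y^K` induced by a map `f : K ⟶ L` of simplicial sets, the transpose of
`A ⊗ K ⟶ A ⊗ L`. -/
noncomputable def cotensorMap {K L : SSet.{u}} (f : K ⟶ L) : cotensor T L ⟶ cotensor T K :=
  conjugateEquiv (Adjunction.ofIsLeftAdjoint (T.obj L)) (Adjunction.ofIsLeftAdjoint (T.obj K))
    (T.map f)

variable {C : Type u} [SmallCategory C] [HasProducts.{u} M]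

/-- `∏_c X(c)^{B(C ↓ c)}` -/
noncomputable abbrev holimSource (X : C ⥤ M) : M :=
  ∏ᶜ fun c : C => (cotensor T (nerve (Over c))).obj (X.obj c)

/-- `∏_{σ : c → d} X(d)^{B(C ↓ c)}`, the product being over all the morphisms of `C`. -/
noncomputable abbrev holimTarget (X : C ⥤ M) : M :=
  ∏ᶜ fun σ : Arrow C => (cotensor T (nerve (Over σ.left))).obj (X.obj σ.right)

/-- The map `α`, with `σ : c → d` component `X(c)^{B(C ↓ c)} ⟶ X(d)^{B(C ↓ c)}`. -/
noncomputable def holimAlpha (X : C ⥤ M) : holimSource T X ⟶ holimTarget T X :=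
  Pi.lift fun σ => Pi.π _ σ.left ≫ (cotensor T (nerve (Over σ.left))).map (X.map σ.hom)

/-- The map `β`, with `σ : c → d` component `X(d)^{B(C ↓ d)} ⟶ X(d)^{B(C ↓ c)}`. -/
noncomputable def holimBeta (X : C ⥤ M) : holimSource T X ⟶ holimTarget T X :=
  Pi.lift fun σ => Pi.π _ σ.right ≫
    (cotensorMap T (nerveMap (Over.map σ.hom))).app (X.obj σ.right)

/-- The map on `∏_c X(c)^{B(C ↓ c)}` induced by a map of diagrams. -/
noncomputable def holimSourceMap {X Y : C ⥤ M} (f : X ⟶ Y) : holimSource T X ⟶ holimSource T Y :=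
  Limits.Pi.map fun c => (cotensor T (nerve (Over c))).map (f.app c)

/-- The map on `∏_σ X(d)^{B(C ↓ c)}` induced by a map of diagrams. -/
noncomputable def holimTargetMap {X Y : C ⥤ M} (f : X ⟶ Y) : holimTarget T X ⟶ holimTarget T Y :=
  Limits.Pi.map fun σ => (cotensor T (nerve (Over σ.left))).map (f.app σ.right)

lemma holimAlpha_naturality {X Y : C ⥤ M} (f : X ⟶ Y) :
    holimAlpha T X ≫ holimTargetMap T f = holimSourceMap T f ≫ holimAlpha T Y := by
  apply Pi.hom_ext
  intro σ
  simp [holimAlpha, holimTargetMap, holimSourceMap, ← Functor.map_comp]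

lemma holimBeta_naturality {X Y : C ⥤ M} (f : X ⟶ Y) :
    holimBeta T X ≫ holimTargetMap T f = holimSourceMap T f ≫ holimBeta T Y := by
  apply Pi.hom_ext
  intro σ
  simp [holimBeta, holimTargetMap, holimSourceMap]

/-- The homotopy limit of `C`-diagrams in `M`: the equalizer of `α` and `β`. -/
noncomputable def holim [HasEqualizers M] : (C ⥤ M) ⥤ M where
  obj X := equalizer (holimAlpha T X) (holimBeta T X)
  map {X Y} f := equalizer.lift (equalizer.ι _ _ ≫ holimSourceMap T f) (by
    rw [Category.assoc, Category.assoc, ← holimAlpha_naturality, ← holimBeta_naturality,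
      equalizer.condition_assoc])
  map_id X := by
    apply equalizer.hom_ext
    simp [holimSourceMap]
  map_comp f g := by
    apply equalizer.hom_ext
    rw [equalizer.lift_ι, Category.assoc, equalizer.lift_ι, equalizer.lift_ι_assoc,
      Category.assoc]
    congr 1
    apply Pi.hom_ext
    intro c
    simp [holimSourceMap]

end Holim

/-! ### Discrete `G`-spectra -/

namespace GSpt

open Spt

section Sub

variable {G : Type u} [Group G]

/-- The action of `g` on a simplex of a `G`-spectrum. -/
def act (Y : Action Spt.{u} G) (g : G) {k : ℕ} {n : SimplexCategoryᵒᵖ} (x : Y.V.S k n) :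
    Y.V.S k n := ev (Y.ρ g) k n x

lemma act_one (Y : Action Spt.{u} G) {k n} (x : Y.V.S k n) : act Y 1 x = x := by
  rw [act, Y.ρ.map_one]; rfl

lemma act_mul (Y : Action Spt.{u} G) (g h : G) {k n} (x : Y.V.S k n) :
    act Y (g * h) x = act Y g (act Y h x) := by
  rw [act, Y.ρ.map_mul]; rfl

/-- A `G`-invariant subspectrum of a `G`-spectrum. -/
structure SubG (Y : Action Spt.{u} G) where
  mem : ∀ k n, Set (Y.V.S k n)
  map_mem : ∀ {k m n} (s : m ⟶ n) {x : Y.V.S k m}, x ∈ mem k m → (Y.V.level k).X.map s x ∈ mem k n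
  pt_mem : ∀ k n, (Y.V.level k).pt n ∈ mem k n
  bd_mem : ∀ {k n} (s) {x : Y.V.S k n}, x ∈ mem k n → Y.V.bd k n s x ∈ mem (k + 1) n
  act_mem : ∀ {k n} (g : G) {x : Y.V.S k n}, x ∈ mem k n → act Y g x ∈ mem k n

variable {Y : Action Spt.{u} G}

/-- The spectrum underlying an invariant subspectrum. -/
def SubG.spt (P : SubG Y) : Spt.{u} :=
  Spt.mk'
    (fun k =>
      { X :=
          { obj := fun n => { x : Y.V.S k n // x ∈ P.mem k n }
            map := fun s => ↾fun x => ⟨(Y.V.level k).X.map s x.1, P.map_mem s x.2⟩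
            map_id := fun n => by ext x; simp
            map_comp := fun s t => by ext x; simp }
        pt := fun n => ⟨(Y.V.level k).pt n, P.pt_mem k n⟩
        map_pt := fun s => by apply Subtype.ext; simp })
    (fun k n s x => ⟨Y.V.bd k n s x.1, P.bd_mem s x.2⟩)
    (fun k n x => by apply Subtype.ext; simp)
    (fun k n s => by apply Subtype.ext; simp)
    (fun k m n t s x => by
      apply Subtype.ext
      exact bd_map _ k t s _)

/-- The `G`-spectrum underlying an invariant subspectrum. -/
def SubG.toAction (P : SubG Y) : Action Spt.{u} G where
  V := P.spt
  ρ :=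
    { toFun := fun g => Spt.mkHom (fun k n x => ⟨act Y g x.1, P.act_mem g x.2⟩)
        (fun k m n s x => by apply Subtype.ext; exact ev_map _ _ _ _)
        (fun k n => by apply Subtype.ext; exact ev_pt _ _ _)
        (fun k n s x => by apply Subtype.ext; exact ev_bd _ _ _ _ _)
      map_one' := by
        apply Spt.hom_ext
        intro k n x
        apply Subtype.ext
        exact act_one Y x.1
      map_mul' := fun g h => by
        apply Spt.hom_ext
        intro k n x
        apply Subtype.ext
        exact act_mul Y g h x.1 }

lemma SubG.act_val (P : SubG Y) (g : G) {k n} (x : P.toAction.V.S k n) :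
    (act P.toAction g x).1 = act Y g x.1 := rfl

/-- The inclusion of one invariant subspectrum in another. -/
def SubG.incl {P Q : SubG Y} (h : ∀ k n, P.mem k n ⊆ Q.mem k n) : P.toAction ⟶ Q.toAction where
  hom := Spt.mkHom (fun k n x => ⟨x.1, h k n x.2⟩) (fun _ _ _ _ _ => rfl) (fun _ _ => rfl)
    (fun _ _ _ _ => rfl)
  comm _ := rfl

end Sub

variable (G : Type u) [Group G] [TopologicalSpace G]

/-- A `G`-spectrum is discrete if, for all `k` and `n`, the action map
`G × (Y_k)_n → (Y_k)_n` is continuous for the discrete topology on `(Y_k)_n`. -/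
def IsDiscrete : ObjectProperty (Action Spt.{u} G) := fun Y =>
  ∀ (k : ℕ) (n : SimplexCategoryᵒᵖ), letI : TopologicalSpace (Y.V.S k n) := ⊥
    Continuous fun p : G × Y.V.S k n => act Y p.1 p.2

/-- The category `Spt_G` of discrete `G`-spectra and `G`-equivariant maps of spectra. -/
abbrev SptG : Type (u + 1) := (IsDiscrete.{u} G).FullSubcategory

/-- The forgetful functor from discrete `G`-spectra to spectra. -/
abbrev SptG.forget : SptG.{u} G ⥤ Spt.{u} := (IsDiscrete.{u} G).ι ⋙ Action.forget Spt.{u} G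

variable {G} [IsTopologicalGroup G]

/-- A `G`-spectrum is discrete if and only if all stabilizers of simplices are open. -/
lemma isDiscrete_iff (Y : Action Spt.{u} G) :
    IsDiscrete G Y ↔ ∀ k n (x : Y.V.S k n), IsOpen {g | act Y g x = x} := by
  refine forall_congr' fun k => forall_congr' fun n => ?_
  let _ : TopologicalSpace (Y.V.S k n) := ⊥
  have _ : DiscreteTopology (Y.V.S k n) := ⟨rfl⟩
  constructor
  · intro h x
    have h' : Continuous fun g : G => act Y g x :=
      Continuous.comp (g := fun p : G × Y.V.S k n => act Y p.1 p.2) h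
        (continuous_id.prodMk continuous_const)
    exact (isOpen_discrete {x}).preimage h'
  · intro h
    change Continuous fun p : G × Y.V.S k n => act Y p.1 p.2
    rw [continuous_iff_continuousAt]
    rintro ⟨g, x⟩
    rw [ContinuousAt, nhds_discrete (Y.V.S k n), Filter.tendsto_pure]
    have hU : IsOpen ({g' | act Y (g⁻¹ * g') x = x} ×ˢ ({x} : Set (Y.V.S k n))) :=
      ((h x).preimage (continuous_const_mul g⁻¹)).prod (isOpen_discrete _)
    filter_upwards [hU.mem_nhds (x := (g, x)) (by simp [act_one])]
    rintro ⟨g', y⟩ ⟨h1, h2⟩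
    obtain rfl : y = x := h2
    have h1 : act Y (g⁻¹ * g') y = y := h1
    change act Y g' y = act Y g y
    conv_rhs => rw [← h1]
    rw [← act_mul, mul_inv_cancel_left]

/-- The stabilizer of a simplex. -/
def stab (Y : Action Spt.{u} G) {k n} (x : Y.V.S k n) : Subgroup G where
  carrier := {g | act Y g x = x}
  one_mem' := act_one Y x
  mul_mem' {a b} ha hb := by
    change act Y (a * b) x = x
    rw [act_mul, show act Y b x = x from hb, show act Y a x = x from ha]
  inv_mem' {a} ha := by
    change act Y a⁻¹ x = x
    conv_lhs => rw [← show act Y a x = x from ha]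
    rw [← act_mul, inv_mul_cancel, act_one]

lemma isOpen_stab_of_imp {Y Z : Action Spt.{u} G} {k n l m} {x : Y.V.S k n} {y : Z.V.S l m}
    (hx : IsOpen {g | act Y g x = x}) (h : ∀ g, act Y g x = x → act Z g y = y) :
    IsOpen {g | act Z g y = y} :=
  Subgroup.isOpen_mono (H₁ := stab Y x) (H₂ := stab Z y) h hx

/-- The simplices with open stabilizer. -/
def discSub (Y : Action Spt.{u} G) : SubG Y where
  mem k n := {x | IsOpen {g | act Y g x = x}}
  map_mem {k m n} s x hx := isOpen_stab_of_imp (Y := Y) (Z := Y) hx fun g h => by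
    rw [act] at h ⊢; rw [ev_map, h]
  pt_mem k n := by
    have : {g | act Y g ((Y.V.level k).pt n) = (Y.V.level k).pt n} = Set.univ := by
      ext g; simp [act]
    rw [Set.mem_ofPred_eq, this]; exact isOpen_univ
  bd_mem {k n} s x hx := isOpen_stab_of_imp (Y := Y) (Z := Y) hx fun g h => by
    rw [act] at h ⊢; rw [ev_bd, h]
  act_mem {k n} g x hx := by
    have : {h | act Y h (act Y g x) = act Y g x} =
        (fun h => g⁻¹ * h * g) ⁻¹' {h | act Y h x = x} := by
      ext h
      simp only [Set.mem_ofPred_eq, Set.mem_preimage, act_mul]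
      constructor
      · intro e; rw [e, ← act_mul, inv_mul_cancel, act_one]
      · intro e
        have := congrArg (act Y g) e
        rwa [← act_mul Y g g⁻¹, mul_inv_cancel, act_one] at this
    rw [Set.mem_ofPred_eq, this]
    exact IsOpen.preimage (by fun_prop) hx

/-- The largest discrete sub-`G`-spectrum of a `G`-spectrum. -/
def disc (Y : Action Spt.{u} G) : SptG.{u} G where
  obj := (discSub Y).toAction
  property := (isDiscrete_iff _).2 fun k n x => by
    have : {g | act (discSub Y).toAction g x = x} = {g | act Y g x.1 = x.1} := by
      ext g; exact Subtype.ext_iff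
    rw [this]; exact x.2

/-- Maps from a discrete `G`-spectrum land in the largest discrete sub-`G`-spectrum. -/
def discEquiv (A : SptG.{u} G) (Y : Action Spt.{u} G) : (A.obj ⟶ Y) ≃ (A ⟶ disc Y) where
  toFun f := ObjectProperty.homMk
    { hom := Spt.mkHom (fun k n x => ⟨ev f.hom k n x,
        isOpen_stab_of_imp (Y := A.obj) (Z := Y) ((isDiscrete_iff _).1 A.property k n x)
          fun g h => by
            have := congr_ev (f.comm g) k n x
            rw [ev_comp, ev_comp] at this
            rw [act] at h
            rw [act, ← this, h]⟩)
        (fun k m n s x => by apply Subtype.ext; exact ev_map _ _ _ _)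
        (fun k n => by apply Subtype.ext; exact ev_pt _ _ _)
        (fun k n s x => by apply Subtype.ext; exact ev_bd _ _ _ _ _)
      comm := fun g => by
        apply Spt.hom_ext
        intro k n x
        apply Subtype.ext
        exact congr_ev (f.comm g) k n x }
  invFun f :=
    { hom := Spt.mkHom (fun k n x => (ev f.hom.hom k n x).1)
        (fun k m n s x => congrArg Subtype.val (ev_map f.hom.hom k s x))
        (fun k n => congrArg Subtype.val (ev_pt f.hom.hom k n))
        (fun k n s x => congrArg Subtype.val (ev_bd f.hom.hom k n s x))
      comm := fun g => by
        apply Spt.hom_ext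
        intro k n x
        exact congrArg Subtype.val (congr_ev (f.hom.comm g) k n x) }
  left_inv _ := rfl
  right_inv _ := rfl

noncomputable instance : Coreflective (IsDiscrete.{u} G).ι where
  R := Adjunction.rightAdjointOfEquiv (F := (IsDiscrete.{u} G).ι) discEquiv (fun _ _ _ _ _ => rfl)
  adj := Adjunction.adjunctionOfEquivRight (F := (IsDiscrete.{u} G).ι) discEquiv
    (fun _ _ _ _ _ => rfl)

instance : HasLimits (SptG.{u} G) := hasLimits_of_coreflective (IsDiscrete.{u} G).ι

/-- The tensor `A ∧ K₊` of a discrete `G`-spectrum, with `G` acting on `A` only, is discrete. -/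
lemma isDiscrete_tensor (K : SSet.{u}) (A : Action Spt.{u} G) (hA : IsDiscrete G A) :
    IsDiscrete G (((Spt.tensor.obj K).mapAction G).obj A) := by
  rw [isDiscrete_iff] at hA ⊢
  intro k n
  refine tens_ind (X := A.V) (K := K) ?_
  intro x y
  refine isOpen_stab_of_imp (Y := A) (Z := ((Spt.tensor.obj K).mapAction G).obj A)
    (hA k n x) fun g h => ?_
  change ev (tensMap (A.ρ g) (𝟙 K)) k n (tmk x y) = tmk x y
  rw [ev_tensMap, show ev (A.ρ g) k n x = x from h]
  rcases y with _ | y <;> rfl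

/-- The tensoring of discrete `G`-spectra over simplicial sets: `K ↦ (A ↦ A ∧ K₊)`, where `G`
acts on `A` only. -/
def tensorG : SSet.{u} ⥤ SptG.{u} G ⥤ SptG.{u} G where
  obj K := (IsDiscrete.{u} G).lift ((IsDiscrete.{u} G).ι ⋙ (Spt.tensor.obj K).mapAction G)
    (fun A => isDiscrete_tensor K A.obj A.property)
  map f :=
    { app := fun A => ObjectProperty.homMk
        { hom := (Spt.tensor.map f).app A.obj.V
          comm := fun g => (Spt.tensor.map f).naturality (A.obj.ρ g) }
      naturality := fun A B h => by
        apply ObjectProperty.hom_ext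
        apply Action.hom_ext
        exact (Spt.tensor.map f).naturality h.hom.hom }
  map_id K := by
    ext A : 4
    exact congrArg (fun φ => NatTrans.app φ A.obj.V) (Spt.tensor.map_id K)
  map_comp f g := by
    ext A : 4
    exact congrArg (fun φ => NatTrans.app φ A.obj.V) (Spt.tensor.map_comp f g)

/-- An adjunction lifts to objects with a `G`-action. -/
def mapActionAdj {V W : Type*} [Category* V] [Category* W] {L : V ⥤ W} {R : W ⥤ V} (adj : L ⊣ R) :
    L.mapAction G ⊣ R.mapAction G where
  unit :=
    { app := fun A => { hom := adj.unit.app A.V, comm := fun g => adj.unit.naturality (A.ρ g) }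
      naturality := fun A B f => by
        apply Action.hom_ext
        exact adj.unit.naturality f.hom }
  counit :=
    { app := fun A => { hom := adj.counit.app A.V, comm := fun g => adj.counit.naturality (A.ρ g) }
      naturality := fun A B f => by
        apply Action.hom_ext
        exact adj.counit.naturality f.hom }
  left_triangle_components A := by
    apply Action.hom_ext
    exact adj.left_triangle_components A.V
  right_triangle_components A := by
    apply Action.hom_ext
    exact adj.right_triangle_components A.V

/-- The tensor functor `- ∧ K₊` on discrete `G`-spectra has a right adjoint. -/
instance (K : SSet.{u}) : ((tensorG (G := G)).obj K).IsLeftAdjoint :=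
  (Adjunction.restrictFullyFaithful (L := (tensorG (G := G)).obj K)
    ((coreflectorAdjunction (IsDiscrete.{u} G).ι).comp
      (mapActionAdj (G := G) (Adjunction.ofIsLeftAdjoint (Spt.tensor.obj K))))
    (Functor.FullyFaithful.id _) (IsDiscrete.{u} G).fullyFaithfulι
    (Iso.refl _) (Functor.rightUnitor _).symm).isLeftAdjoint

/-- The fixed points `Y^N` of a normal subgroup `N`, as a `G`-invariant subspectrum. -/
def fixSub (Y : Action Spt.{u} G) (N : Subgroup G) [N.Normal] : SubG Y where
  mem k n := {x | ∀ h ∈ N, act Y h x = x}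
  map_mem {k m n} s x hx h hh := by
    have := hx h hh
    rw [act] at this ⊢; rw [ev_map, this]
  pt_mem k n h _ := ev_pt _ _ _
  bd_mem {k n} s x hx h hh := by
    have := hx h hh
    rw [act] at this ⊢; rw [ev_bd, this]
  act_mem {k n} g x hx h hh := by
    have := hx (g⁻¹ * h * g) (by simpa using Subgroup.Normal.conj_mem ‹_› h hh g⁻¹)
    have := congrArg (act Y g) this
    simpa [← act_mul, mul_assoc] using this

/-- The diagram `N ↦ Y^N` of discrete `G`-spectra indexed by the open normal subgroups of `G`,
where `Y^{N'} ⟶ Y^N` is the inclusion if `N ≤ N'`. -/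
def fixedPoints (Y : Action Spt.{u} G) : (OpenNormalSubgroup G)ᵒᵖ ⥤ SptG.{u} G where
  obj N :=
    { obj := (fixSub Y N.unop.toSubgroup).toAction
      property := (isDiscrete_iff _).2 fun _ _ x =>
        Subgroup.isOpen_mono (H₁ := N.unop.toSubgroup) (H₂ := stab _ x)
          (fun h hh => show act _ h x = x from Subtype.ext (x.2 h hh)) N.unop.isOpen' }
  map f := ObjectProperty.homMk (SubG.incl fun _ _ _ hx h hh => hx h (leOfHom f.unop hh))
  map_id _ := rfl
  map_comp _ _ := rfl

/-- The action of `g` on the underlying diagram of spectra of a diagram of discrete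
`G`-spectra. -/
def diagAct {C : Type u} [SmallCategory C] (X : C ⥤ SptG.{u} G) (g : G) :
    (X ⋙ SptG.forget G) ⟶ (X ⋙ SptG.forget G) where
  app c := (X.obj c).obj.ρ g
  naturality _ _ f := ((X.map f).hom.comm g).symm

lemma diagAct_one {C : Type u} [SmallCategory C] (X : C ⥤ SptG.{u} G) :
    diagAct X 1 = 𝟙 (X ⋙ SptG.forget G) := by
  ext c : 2
  exact (X.obj c).obj.ρ.map_one

lemma diagAct_mul {C : Type u} [SmallCategory C] (X : C ⥤ SptG.{u} G) (g h : G) :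
    diagAct X (g * h) = diagAct X h ≫ diagAct X g := by
  ext c : 2
  exact (X.obj c).obj.ρ.map_mul g h

/-- The spectrum `holim_C X` of a diagram of discrete `G`-spectra, formed in spectra, with the
`G`-action induced by functoriality from the actions on the `X(c)`. -/
noncomputable def holimSpt {C : Type u} [SmallCategory C] (X : C ⥤ SptG.{u} G) :
    Action Spt.{u} G where
  V := (holim Spt.tensor.{u}).obj (X ⋙ SptG.forget G)
  ρ :=
    { toFun := fun g => (holim Spt.tensor.{u}).map (diagAct X g)
      map_one' := by rw [diagAct_one, CategoryTheory.Functor.map_id]; rfl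
      map_mul' := fun g h => by rw [diagAct_mul, CategoryTheory.Functor.map_comp]; rfl }

/-- The homotopy limit of a diagram of discrete `G`-spectra, formed in `Spt_G`. -/
noncomputable abbrev holimG {C : Type u} [SmallCategory C] (X : C ⥤ SptG.{u} G) : SptG.{u} G :=
  (holim (tensorG (G := G))).obj X

end GSpt

/-!
By the tensor-cotensor adjunctions, maps `A ⟶ holim X` are the families of maps
`A ∧ B(C ↓ c)₊ ⟶ X(c)` compatible with the morphisms of `C`. For discrete `A` and `X`, such a
family consists of equivariant maps exactly when the map `A ⟶ holim X` in spectra which it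
classifies is equivariant. So the homotopy limit in discrete `G`-spectra represents the same
presheaf as the largest discrete sub-`G`-spectrum of the homotopy limit in spectra. A simplex of
the latter has an open stabilizer, which contains an open normal subgroup; hence the largest
discrete sub-`G`-spectrum is the directed union of the fixed points of open normal subgroups.
-/

lemma homEquiv_app_comp_eq_comp_conjugateEquiv {V W : Type*} [Category* V] [Category* W]
    {L₁ L₂ : V ⥤ W} {R₁ R₂ : W ⥤ V} (adj₁ : L₁ ⊣ R₁) (adj₂ : L₂ ⊣ R₂) (α : L₂ ⟶ L₁)
    {A : V} {Y : W} (f : L₁.obj A ⟶ Y) :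
    adj₂.homEquiv A Y (α.app A ≫ f) =
      adj₁.homEquiv A Y f ≫ (conjugateEquiv adj₁ adj₂ α).app Y := by
  rw [Adjunction.homEquiv_unit, Adjunction.homEquiv_unit, Functor.map_comp, Category.assoc,
    NatTrans.naturality, ← Category.assoc, ← Category.assoc, unit_conjugateEquiv]

section Holim

variable {M : Type*} [Category* M] (T : SSet.{u} ⥤ M ⥤ M) {C : Type u} [SmallCategory C]

/-- A cone over `X` for the homotopy limit, with vertex `A`: a family of maps
`A ⊗ B(C ↓ c) ⟶ X(c)` compatible with the morphisms of `C`. -/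
@[ext]
structure HolimCone (A : M) (X : C ⥤ M) where
  app : ∀ c, (T.obj (nerve (Over c))).obj A ⟶ X.obj c
  w : ∀ {c d} (σ : c ⟶ d), app c ≫ X.map σ = (T.map (nerveMap (Over.map σ))).app A ≫ app d

namespace HolimCone

variable {T} {A B : M} {X Y : C ⥤ M}

/-- The restriction of a cone along a map of vertices. -/
@[simps]
def precomp (f : A ⟶ B) (s : HolimCone T B X) : HolimCone T A X where
  app c := (T.obj _).map f ≫ s.app c
  w σ := by rw [Category.assoc, s.w, NatTrans.naturality_assoc]

/-- The image of a cone under a map of diagrams. -/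
@[simps]
def postcomp (s : HolimCone T A X) (f : X ⟶ Y) : HolimCone T A Y where
  app c := s.app c ≫ f.app c
  w σ := by rw [Category.assoc, ← f.naturality, reassoc_of% s.w σ]

end HolimCone

/-- The presheaf of cones over `X` for the homotopy limit. -/
def holimCones (X : C ⥤ M) : Mᵒᵖ ⥤ Type _ where
  obj A := HolimCone T A.unop X
  map f := ↾(HolimCone.precomp f.unop)

variable [∀ K, (T.obj K).IsLeftAdjoint]

/-- The adjunction that defines the cotensor. -/
noncomputable def cotensorAdj (K : SSet.{u}) : T.obj K ⊣ cotensor T K :=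
  Adjunction.ofIsLeftAdjoint (T.obj K)

lemma cotensorAdj_homEquiv_app_comp {K L : SSet.{u}} (k : K ⟶ L) {A Y : M}
    (f : (T.obj L).obj A ⟶ Y) :
    (cotensorAdj T K).homEquiv A Y ((T.map k).app A ≫ f) =
      (cotensorAdj T L).homEquiv A Y f ≫ (cotensorMap T k).app Y :=
  homEquiv_app_comp_eq_comp_conjugateEquiv _ _ _ f

variable [HasProducts.{u} M] [HasEqualizers M] (X : C ⥤ M)

/-- The projection from the homotopy limit of `X` to `X(c)^{B(C ↓ c)}`. -/
noncomputable def holimProj (c : C) :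
    (holim T).obj X ⟶ (cotensor T (nerve (Over c))).obj (X.obj c) :=
  equalizer.ι (holimAlpha T X) (holimBeta T X) ≫ Pi.π _ c

variable {X}

lemma holimProj_w {c d : C} (σ : c ⟶ d) :
    holimProj T X c ≫ (cotensor T (nerve (Over c))).map (X.map σ) =
      holimProj T X d ≫ (cotensorMap T (nerveMap (Over.map σ))).app (X.obj d) := by
  have h := equalizer.condition (holimAlpha T X) (holimBeta T X) =≫ Pi.π _ (Arrow.mk σ)
  simp only [holimAlpha, holimBeta, Category.assoc, Limits.Pi.lift_π] at h
  exact (Category.assoc _ _ _).trans (h.trans (Category.assoc _ _ _).symm)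

lemma holim_map_comp_holimProj {Y : C ⥤ M} (f : X ⟶ Y) (c : C) :
    (holim T).map f ≫ holimProj T Y c =
      holimProj T X c ≫ (cotensor T (nerve (Over c))).map (f.app c) := by
  have h : holimSourceMap T f ≫ Pi.π _ c = Pi.π _ c ≫ (cotensor T _).map (f.app c) :=
    Limits.Pi.map_π _ _
  calc
    _ = (equalizer.ι (holimAlpha T X) (holimBeta T X) ≫ holimSourceMap T f) ≫ Pi.π _ c :=
      equalizer.lift_ι_assoc _ _ _
    _ = _ := (Category.assoc _ _ _).trans ((_ ≫= h).trans (Category.assoc _ _ _).symm)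

lemma holim_hom_ext {A : M} {φ ψ : A ⟶ (holim T).obj X}
    (h : ∀ c, φ ≫ holimProj T X c = ψ ≫ holimProj T X c) : φ = ψ :=
  equalizer.hom_ext <| Pi.hom_ext _ _ fun c =>
    (Category.assoc _ _ _).trans ((h c).trans (Category.assoc _ _ _).symm)

/-- The map to the homotopy limit classified by a cone. -/
noncomputable def holimLift {A : M} (s : HolimCone T A X) : A ⟶ (holim T).obj X :=
  equalizer.lift (Pi.lift fun c => (cotensorAdj T _).homEquiv _ _ (s.app c)) <| by
    refine Pi.hom_ext _ _ fun σ => ?_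
    simp only [holimAlpha, holimBeta, Category.assoc, Limits.Pi.lift_π, Limits.Pi.lift_π_assoc,
      ← Adjunction.homEquiv_naturality_right, ← cotensorAdj_homEquiv_app_comp, s.w]

lemma holimLift_comp_holimProj {A : M} (s : HolimCone T A X) (c : C) :
    holimLift T s ≫ holimProj T X c = (cotensorAdj T _).homEquiv _ _ (s.app c) :=
  (equalizer.lift_ι_assoc _ _ _).trans (Limits.Pi.lift_π _ _)

/-- The cone classified by a map to the homotopy limit. -/
@[simps]
noncomputable def holimConeOfHom {A : M} (φ : A ⟶ (holim T).obj X) : HolimCone T A X where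
  app c := ((cotensorAdj T _).homEquiv _ _).symm (φ ≫ holimProj T X c)
  w σ := by
    apply ((cotensorAdj T _).homEquiv _ _).injective
    rw [Adjunction.homEquiv_naturality_right, cotensorAdj_homEquiv_app_comp,
      Equiv.apply_symm_apply, Equiv.apply_symm_apply, Category.assoc, Category.assoc, holimProj_w]

variable (X) in
/-- Maps from `A` to the homotopy limit of `X` are cones over `X` with vertex `A`. -/
noncomputable def holimEquiv (A : M) : (A ⟶ (holim T).obj X) ≃ HolimCone T A X where
  toFun := holimConeOfHom T
  invFun := holimLift T
  left_inv φ := holim_hom_ext T fun c => by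
    rw [holimLift_comp_holimProj, holimConeOfHom_app, Equiv.apply_symm_apply]
  right_inv s := by
    ext c
    rw [holimConeOfHom_app, holimLift_comp_holimProj, Equiv.symm_apply_apply]

lemma holimEquiv_comp {A B : M} (f : A ⟶ B) (φ : B ⟶ (holim T).obj X) :
    holimEquiv T X A (f ≫ φ) = (holimEquiv T X B φ).precomp f := by
  ext c
  simp only [holimEquiv, Equiv.coe_fn_mk, holimConeOfHom_app, HolimCone.precomp_app,
    Category.assoc, Adjunction.homEquiv_naturality_left_symm]

lemma holimEquiv_comp_map {A : M} {Y : C ⥤ M} (φ : A ⟶ (holim T).obj X) (f : X ⟶ Y) :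
    holimEquiv T Y A (φ ≫ (holim T).map f) = (holimEquiv T X A φ).postcomp f := by
  ext c
  simp only [holimEquiv, Equiv.coe_fn_mk, holimConeOfHom_app, HolimCone.postcomp_app,
    Category.assoc, holim_map_comp_holimProj]
  rw [← Category.assoc, Adjunction.homEquiv_naturality_right_symm]

variable (X) in
/-- The homotopy limit of `X` represents the presheaf of cones over `X`. -/
noncomputable def holimRepresentableBy : (holimCones T X).RepresentableBy ((holim T).obj X) where
  homEquiv {A} := holimEquiv T X A
  homEquiv_comp f φ := holimEquiv_comp T f φ

end Holim

namespace Spt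

/-- The functor sending a spectrum to the set of `n`-simplices of its `k`-th level. -/
def simplices (k : ℕ) (n : SimplexCategoryᵒᵖ) : Spt.{u} ⥤ Type u where
  obj X := X.S k n
  map f := ↾(ev f k n)

section

variable {J : Type*} [Category* J] {F : J ⥤ Spt.{u}} {c : Cocone F}
  (hc : ∀ k n, IsColimit ((simplices k n).mapCocone c))

/-- The function on simplices induced by a cocone `s`, if the simplices of `c` form colimits of
sets. -/
noncomputable def descSimplices (s : Cocone F) (k n) (x : c.pt.S k n) : s.pt.S k n :=
  (hc k n).desc ((simplices k n).mapCocone s) x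

lemma descSimplices_ev (s : Cocone F) (j : J) (k n) (x : (F.obj j).S k n) :
    descSimplices hc s k n (ev (c.ι.app j) k n x) = ev (s.ι.app j) k n x :=
  ConcreteCategory.congr_hom ((hc k n).fac ((simplices k n).mapCocone s) j) x

include hc in
lemma exists_ev_eq_of_isColimit (k n) (x : c.pt.S k n) : ∃ j y, ev (c.ι.app j) k n y = x :=
  Types.jointly_surjective _ (hc k n) x

/-- The simplices functors jointly reflect nonempty colimits. -/
noncomputable def isColimitOfSimplices [Nonempty J] : IsColimit c where
  desc s := mkHom (descSimplices hc s)
    (fun k m n t x => by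
      obtain ⟨j, x, rfl⟩ := exists_ev_eq_of_isColimit hc k m x
      rw [← ev_map, descSimplices_ev, descSimplices_ev]
      exact ev_map (s.ι.app j) k t x)
    (fun k n => by
      obtain ⟨j⟩ := ‹Nonempty J›
      calc
        _ = descSimplices hc s k n (ev (c.ι.app j) k n (((F.obj j).level k).pt n)) :=
          congrArg _ (ev_pt (c.ι.app j) k n).symm
        _ = _ := (descSimplices_ev hc s j k n _).trans (ev_pt (s.ι.app j) k n))
    (fun k n t x => by
      obtain ⟨j, x, rfl⟩ := exists_ev_eq_of_isColimit hc k n x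
      rw [← ev_bd, descSimplices_ev, descSimplices_ev]
      exact ev_bd (s.ι.app j) k n t x)
  fac s j := hom_ext (descSimplices_ev hc s j)
  uniq s m hm := hom_ext fun k n x => by
    obtain ⟨j, x, rfl⟩ := exists_ev_eq_of_isColimit hc k n x
    exact (congr_ev (hm j) k n x).trans (descSimplices_ev hc s j k n x).symm

end

/-- A directed union of subspectra, in terms of simplices, is a colimit. -/
noncomputable def isColimitOfInjective {J : Type*} [Category* J] [IsFiltered J] {F : J ⥤ Spt.{u}}
    (c : Cocone F)
    (hinj : ∀ j k n, Function.Injective (ev (c.ι.app j) k n))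
    (hsurj : ∀ k n (x : c.pt.S k n), ∃ j y, ev (c.ι.app j) k n y = x) : IsColimit c :=
  have : Nonempty J := IsFiltered.nonempty
  isColimitOfSimplices fun k n => Types.FilteredColimit.isColimitOf' _ _
    (fun x => (hsurj k n x).imp fun _ ⟨y, hy⟩ => ⟨y, hy.symm⟩)
    (fun j _ _ h => ⟨j, 𝟙 j, by rw [hinj j k n h]⟩)

end Spt

namespace GSpt

open Spt

section HolimSpt

variable {G : Type u} [Group G] [TopologicalSpace G] {C : Type u} [SmallCategory C]
  (X : C ⥤ SptG.{u} G)

variable {X} in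
/-- Equivariance of a cone of spectra: the action on the vertex agrees with that on the
diagram. -/
def IsEquivariant {A : Action Spt.{u} G}
    (s : HolimCone Spt.tensor A.V (X ⋙ SptG.forget G)) : Prop :=
  ∀ g, s.precomp (A.ρ g) = s.postcomp (diagAct X g)

variable {X} in
lemma isEquivariant_holimEquiv_iff {A : Action Spt.{u} G}
    (φ : A.V ⟶ (holim Spt.tensor).obj (X ⋙ SptG.forget G)) :
    IsEquivariant (holimEquiv Spt.tensor _ A.V φ) ↔
      ∀ g, A.ρ g ≫ φ = φ ≫ (holim Spt.tensor).map (diagAct X g) :=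
  forall_congr' fun g => by
    rw [← holimEquiv_comp, ← holimEquiv_comp_map, Equiv.apply_eq_iff_eq]

variable [IsTopologicalGroup G]

/-- Equivariant maps to the homotopy limit in spectra are equivariant cones of spectra. -/
noncomputable def holimSptEquiv (A : Action Spt.{u} G) : (A ⟶ holimSpt X) ≃
    { s : HolimCone Spt.tensor A.V (X ⋙ SptG.forget G) // IsEquivariant s } where
  toFun φ := ⟨holimEquiv Spt.tensor _ A.V φ.hom, (isEquivariant_holimEquiv_iff _).2 φ.comm⟩
  invFun s :=
    { hom := (holimEquiv Spt.tensor _ A.V).symm s.1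
      comm := (isEquivariant_holimEquiv_iff _).1 <|
        ((holimEquiv Spt.tensor _ A.V).apply_symm_apply s.1).symm ▸ s.2 }
  left_inv _ := Action.hom_ext _ _ (Equiv.symm_apply_apply _ _)
  right_inv _ := Subtype.ext (Equiv.apply_symm_apply _ _)

variable {X} in
/-- The cone of spectra underlying a cone of discrete `G`-spectra. -/
def forgetHolimCone {A : SptG.{u} G} (s : HolimCone tensorG A X) :
    HolimCone Spt.tensor A.obj.V (X ⋙ SptG.forget G) where
  app c := (s.app c).hom.hom
  w σ := congrArg (fun f => f.hom.hom) (s.w σ)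

/-- Cones of discrete `G`-spectra are equivariant cones of spectra. -/
def holimConeEquiv (A : SptG.{u} G) : HolimCone tensorG A X ≃
    { s : HolimCone Spt.tensor A.obj.V (X ⋙ SptG.forget G) // IsEquivariant s } where
  toFun s := ⟨forgetHolimCone s, fun g => HolimCone.ext (funext fun c => (s.app c).hom.comm g)⟩
  invFun s :=
    { app c := ObjectProperty.homMk
        { hom := s.1.app c
          comm g := congrFun (congrArg HolimCone.app (s.2 g)) c }
      w σ := ObjectProperty.hom_ext _ (Action.hom_ext _ _ (s.1.w σ)) }
  left_inv _ := rfl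
  right_inv _ := rfl

/-- Cones of discrete `G`-spectra are maps to the largest discrete sub-`G`-spectrum. -/
noncomputable def discHolimRepresentableBy :
    (holimCones tensorG X).RepresentableBy (disc (holimSpt X)) where
  homEquiv {A} := (discEquiv A _).symm.trans ((holimSptEquiv X _).trans (holimConeEquiv X A).symm)
  homEquiv_comp f φ := HolimCone.ext <| funext fun c =>
    ObjectProperty.hom_ext _ <| Action.hom_ext _ _ <| congrFun (congrArg HolimCone.app
      (holimEquiv_comp Spt.tensor f.hom.hom ((discEquiv _ _).symm φ).hom)) c

/-- The homotopy limit in discrete `G`-spectra is the largest discrete sub-`G`-spectrum of the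
homotopy limit in spectra. -/
noncomputable def holimGIsoDisc : holimG X ≅ disc (holimSpt X) :=
  (holimRepresentableBy tensorG X).uniqueUpToIso (discHolimRepresentableBy X)

end HolimSpt

section FixedPoints

variable {G : Type u} [Group G] [TopologicalSpace G] [IsTopologicalGroup G]

/-- The inclusions of the fixed points `Y^N`, for `N` open normal, in the largest discrete
sub-`G`-spectrum of `Y`. -/
def fixedPointsCocone (Y : Action Spt.{u} G) : Cocone (fixedPoints Y) where
  pt := disc Y
  ι :=
    { app N := ObjectProperty.homMk <| SubG.incl (P := fixSub Y N.unop.toSubgroup) (Q := discSub Y)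
        fun _ _ x hx => Subgroup.isOpen_mono (H₁ := N.unop.toSubgroup) (H₂ := stab Y x) hx
          N.unop.isOpen' }

lemma exists_fixedPointsCocone_ev_eq
    (hG : ∀ H : OpenSubgroup G, ∃ N : OpenNormalSubgroup G, (N : Set G) ⊆ H)
    (Y : Action Spt.{u} G) {k n} (x : (disc Y).obj.V.S k n) :
    ∃ N y, ev (((fixedPointsCocone Y).ι.app N).hom.hom) k n y = x :=
  have ⟨N, hN⟩ := hG { stab Y x.1 with isOpen' := x.2 }
  ⟨op N, ⟨x.1, hN⟩, rfl⟩

/-- The largest discrete sub-`G`-spectrum of `Y` is the colimit in spectra of the `Y^N`. -/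
noncomputable def isColimitForgetFixedPointsCocone
    (hG : ∀ H : OpenSubgroup G, ∃ N : OpenNormalSubgroup G, (N : Set G) ⊆ H)
    (Y : Action Spt.{u} G) : IsColimit ((SptG.forget G).mapCocone (fixedPointsCocone Y)) :=
  have : Nonempty (OpenNormalSubgroup G) := (hG ⊤).nonempty
  isColimitOfInjective _
    (fun _ k n _ _ h => Subtype.ext (congrArg (fun x : (disc Y).obj.V.S k n => x.1) h))
    (fun _ _ => exists_fixedPointsCocone_ev_eq hG Y)

end FixedPoints

end GSpt

theorem theorem2p3_general {G : Type u} [Group G] [TopologicalSpace G] [IsTopologicalGroup G]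
    (hG : ∀ H : OpenSubgroup G, ∃ N : OpenNormalSubgroup G, (N : Set G) ⊆ H)
    {C : Type u} [SmallCategory C] (X : C ⥤ GSpt.SptG.{u} G) :
    ∃ c : Cocone (GSpt.fixedPoints (GSpt.holimSpt X)),
      Nonempty (IsColimit c) ∧
      Nonempty (IsColimit ((GSpt.SptG.forget G).mapCocone c)) ∧
      Nonempty (GSpt.holimG X ≅ c.pt) :=
  have hc := GSpt.isColimitForgetFixedPointsCocone hG (GSpt.holimSpt X)
  ⟨GSpt.fixedPointsCocone (GSpt.holimSpt X), ⟨isColimitOfReflects (GSpt.SptG.forget G) hc⟩, ⟨hc⟩,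
    ⟨GSpt.holimGIsoDisc X⟩⟩

theorem theorem2p3 {G : Type u} [Group G] [TopologicalSpace G] [IsTopologicalGroup G]
    [CompactSpace G] [TotallyDisconnectedSpace G] {C : Type u} [SmallCategory C]
    (X : C ⥤ GSpt.SptG.{u} G) :
    ∃ c : Cocone (GSpt.fixedPoints (GSpt.holimSpt X)),
      Nonempty (IsColimit c) ∧
      Nonempty (IsColimit ((GSpt.SptG.forget G).mapCocone c)) ∧
      Nonempty (GSpt.holimG X ≅ c.pt) :=
  theorem2p3_general (fun H =>
    IsTopologicalGroup.exist_openNormalSubgroup_sub_clopen_nhds_of_one H.isClopen H.one_mem) X
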